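/- Let $\Phi$ be a Matérn cluster process on $\mathbb{R}$ with parent density $\lambda_p>0$, daughter density $\lambda_d>0$ and cluster radius $r_d>0$: the parents $X_0,X_1,\dots$ are the points of a homogeneous Poisson point process on $\mathbb{R}$ of intensity $\lambda_p$; to each parent $X_i$ a daughter process $\Phi_i$ is attached, which is a Poisson point process of density $\lambda_d$ on $\{y:|y|\le r_d\}$; the $\Phi_i$ are independent of each other and of the parents; and $\Phi=\bigcup_i (X_i+\Phi_i)$. Let $r\ge 0$, let $N$ be the number of points of $\Phi$ in $[-r,r]$, let $\mathcal A(r,r_d,x)$ be the length of $[-r,r]\cap[x-r_d,x+r_d]$ (which depends only on $|x|$), and let $\beta(r)=2\min(r,r_d)$. Then $$\mathcal A(r,r_d,x)=\begin{cases}\beta(r) & \text{if } 0\le |x|\le |r-r_d|,\\ r+r_d-|x| & \text{if } |r-r_d|\le |x|\le r+r_d.\end{cases}$$ Moreover, $N$ is almost surely finite, and for every real $s$ with $|s|\le 1$ its probability generating function is $\mathbb{E}[s^N]=e^{g(s)}$, where $$g(s)=2\lambda_p\left(\int_0^{r+r_d}e^{\lambda_d\mathcal A(r,r_d,x)(s-1)}\,dx-(r+r_d)\right),$$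 and for every real $s\ne 1$ $$g(s)=2\lambda_p\left[|r-r_d|\,e^{\lambda_d\beta(r)(s-1)}-(r+r_d)+\frac{e^{\lambda_d(s-1)\beta(r)}-1}{\lambda_d(s-1)}\right].$$ -/

import Mathlib

open MeasureTheory ProbabilityTheory Metric Set
open scoped ENNReal NNReal

noncomputable section

/-- A point process on `E`, given as a random (counting) measure `Φ` on the probability space
`(Ω, μ)`, is a Poisson point process with intensity measure `Λ`: the number of points in every
measurable set `B` of finite intensity is Poisson distributed with mean `Λ B`, and the numbers of
points in finitely many pairwise disjoint measurable sets are independent. Measurability of `Φ`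
means that every `ω ↦ Φ ω B` with `B` measurable is measurable. -/
structure IsPoissonPointProcess {Ω E : Type*} [MeasurableSpace Ω] [MeasurableSpace E]
    (μ : Measure Ω) (Φ : Ω → Measure E) (Λ : Measure E) : Prop where
  measurable : Measurable Φ
  law_count : ∀ B : Set E, MeasurableSet B → Λ B ≠ ∞ →
    μ.map (fun ω => Φ ω B) = (poissonMeasure (Λ B).toNNReal).map (fun k : ℕ => (k : ℝ≥0∞))
  indep_count : ∀ (m : ℕ) (B : Fin m → Set E), (∀ k, MeasurableSet (B k)) →
    Pairwise (fun j k => Disjoint (B j) (B k)) → iIndepFun (fun k ω => Φ ω (B k)) μ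

/-- The ingredients of a Matérn cluster process on `E` with parent density `lamP`, daughter density
`lamD` and cluster radius `rd`. The parent points `X 0, X 1, …` form a homogeneous Poisson
point process of intensity `lamP`. The daughter point process `D i` attached to the `i`-th parent
is a Poisson point process of density `lamD` confined to the ball of radius `rd` around the origin.
The daughter processes are independent of each other and of the family of parent points (their
common law is determined by their intensity). -/
structure IsMaternClusterData {Ω E : Type*} [MeasurableSpace Ω] [NormedAddCommGroup E]
    [MeasureSpace E] (μ : Measure Ω) (lamP lamD rd : ℝ)
    (X : ℕ → Ω → E) (D : ℕ → Ω → Measure E) : Prop where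
  measurable_parent : ∀ i, Measurable (X i)
  parent_poisson : IsPoissonPointProcess μ
    (fun ω => Measure.sum (fun i => Measure.dirac (X i ω)))
    (ENNReal.ofReal lamP • (volume : Measure E))
  daughter_poisson : ∀ i, IsPoissonPointProcess μ (D i)
    (ENNReal.ofReal lamD • (volume : Measure E).restrict (closedBall 0 rd))
  daughter_indep : iIndepFun D μ
  parent_daughter_indep : IndepFun (fun ω i => X i ω) (fun ω i => D i ω) μ

/-- The cluster process: the superposition of all daughter processes `D i`, each translated by its
parent point `X i`, as a counting measure. -/
def clusterProcess {Ω E : Type*} [NormedAddCommGroup E] [MeasurableSpace E]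
    (X : ℕ → Ω → E) (D : ℕ → Ω → Measure E) (ω : Ω) : Measure E :=
  Measure.sum (fun i => (D i ω).map (fun y => X i ω + y))

/-- The number of points of the point process `Φ` in the ball of radius `r` centred at the
origin, as a natural number. -/
def numPoints {Ω E : Type*} [NormedAddCommGroup E] [MeasurableSpace E]
    (Φ : Ω → Measure E) (r : ℝ) (ω : Ω) : ℕ :=
  ⌊(Φ ω (closedBall 0 r)).toReal⌋₊

/-- The volume of the intersection of the ball of radius `r` centred at the origin with the
ball of radius `rd` centred at `x`. -/
def interVol {E : Type*} [NormedAddCommGroup E] [MeasureSpace E] (r rd : ℝ) (x : E) : ℝ :=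
  (volume (closedBall (0 : E) r ∩ closedBall x rd)).toReal

/-- The exponent of the probability generating function of the number of points in the ball of
radius `r`, as an integral over the distance `x` of the parent from the origin, in dimension one:
the general `vₙ λₚ (∫₀^{r + rd} n exp (λ_d A(r, rd, x) (s - 1)) xⁿ⁻¹ dx - (r + rd)ⁿ)`
with `n = 1` and `v₁ = 2`. -/
def pgfExponent (lamP lamD rd r s : ℝ) : ℝ :=
  2 * lamP * ((∫ x in (0 : ℝ)..(r + rd), Real.exp (lamD * interVol r rd x * (s - 1))) - (r + rd))

end

/-! ### Laplace functional of a Poisson point process. -/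

section

open Filter
open scoped Topology

/-! A parent at `x` puts a Poisson number of daughters with mean `lamD * interVol r rd x` into the
ball, with generating function `exp (-f x)`, where `f x = lamD * interVol r rd x * (1 - s)`.
Averaging over the daughters first turns `E[s ^ N]` into the expectation of `exp (-∑ f (X i))`. This
is the Laplace functional of the Poisson parents (`integral_exp_neg_integral`), equal to the
exponential of `lamP` times the integral of `exp (-f) - 1`. As `f` is even and vanishes beyond `r +
rd`, this exponent is `pgfExponent`.

The averaging (`integral_prod_marks`) is done for the first `M` parents only. Almost surely finitely
many parents can reach the ball, so the truncated products converge, and `|s| ≤ 1` bounds them by 1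
for dominated convergence. The closed form follows because the overlap length is a plateau followed
by a line of slope -1. -/

/-- The probability generating function of the Poisson distribution. -/
lemma integral_pow_poissonMeasure (a : ℝ≥0) (s : ℝ) :
    ∫ n : ℕ, s ^ n ∂poissonMeasure a = Real.exp (a * (s - 1)) := by
  rw [integral_poissonMeasure]
  have h := (NormedSpace.expSeries_div_hasSum_exp ((a : ℝ) * s)).mul_left (Real.exp (-a))
  rw [← Real.exp_eq_exp_ℝ, ← Real.exp_add] at h
  rw [show (a : ℝ) * (s - 1) = -a + a * s by ring, ← h.tsum_eq]
  refine tsum_congr fun n => ?_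
  rw [smul_eq_mul, mul_pow]
  ring

lemma tendsto_floor_mul_div {y : ℝ} (hy : 0 ≤ y) :
    Tendsto (fun n : ℕ => (⌊(n : ℝ) * y⌋₊ : ℝ) / n) atTop (𝓝 y) := by
  have := (tendsto_nat_floor_mul_div_atTop hy).comp (tendsto_natCast_atTop_atTop (R := ℝ))
  simpa [Function.comp_def, mul_comm] using this

namespace IsPoissonPointProcess

variable {Ω E : Type*} [MeasurableSpace Ω] [MeasurableSpace E] {μ : Measure Ω}
  {Φ : Ω → Measure E} {Λ : Measure E}

lemma measurable_count (h : IsPoissonPointProcess μ Φ Λ) {B : Set E} (hB : MeasurableSet B) :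
    Measurable fun ω => Φ ω B :=
  (Measure.measurable_coe hB).comp h.measurable

/-- A Poisson law is carried by the naturals. This is also the source of all almost sure finiteness
below. -/
lemma ae_count_eq_natCast (h : IsPoissonPointProcess μ Φ Λ) {B : Set E} (hB : MeasurableSet B)
    (hΛ : Λ B ≠ ∞) : ∀ᵐ ω ∂μ, ∃ k : ℕ, Φ ω B = k := by
  have hm : MeasurableSet (range fun k : ℕ => (k : ℝ≥0∞)) := (countable_range _).measurableSet
  have h1 : ∀ᵐ x ∂(μ.map fun ω => Φ ω B), x ∈ range fun k : ℕ => (k : ℝ≥0∞) := by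
    rw [h.law_count B hB hΛ]
    exact (ae_map_iff (p := fun x => x ∈ range fun k : ℕ => (k : ℝ≥0∞))
      Measurable.of_discrete.aemeasurable hm).2 (ae_of_all _ fun k => ⟨k, rfl⟩)
  filter_upwards [ae_of_ae_map (h.measurable_count hB).aemeasurable h1] with ω hω
  obtain ⟨k, hk⟩ := hω
  exact ⟨k, hk.symm⟩

lemma integral_comp_count (h : IsPoissonPointProcess μ Φ Λ) {B : Set E} (hB : MeasurableSet B)
    (hΛ : Λ B ≠ ∞) {g : ℝ≥0∞ → ℝ} (hg : Measurable g) :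
    ∫ ω, g (Φ ω B) ∂μ = ∫ k : ℕ, g k ∂poissonMeasure (Λ B).toNNReal := by
  rw [← integral_map (φ := fun ω => Φ ω B) (h.measurable_count hB).aemeasurable
    hg.aestronglyMeasurable, h.law_count B hB hΛ,
    integral_map (by fun_prop) hg.aestronglyMeasurable]

lemma ae_count_eq_zero (h : IsPoissonPointProcess μ Φ Λ) {B : Set E} (hB : MeasurableSet B)
    (hΛ : Λ B = 0) : ∀ᵐ ω ∂μ, Φ ω B = 0 := by
  have h1 : ∀ᵐ x ∂(μ.map fun ω => Φ ω B), x = 0 := by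
    rw [h.law_count B hB (by simp [hΛ])]
    refine (ae_map_iff (p := fun x : ℝ≥0∞ => x = 0) Measurable.of_discrete.aemeasurable
      (measurableSet_singleton 0)).2 ?_
    rw [ae_iff]
    have : {a : ℕ | ¬ (a : ℝ≥0∞) = 0} = {0}ᶜ := by ext; simp
    rw [this, prob_compl_eq_zero_iff (measurableSet_singleton _), poissonMeasure_singleton]
    simp [hΛ]
  exact ae_of_ae_map (h.measurable_count hB).aemeasurable h1

/-- The Laplace functional of a Poisson point process at a function with finitely many values. -/
lemma integral_exp_neg_sum (h : IsPoissonPointProcess μ Φ Λ) {m : ℕ} {B : Fin m → Set E}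
    (hB : ∀ k, MeasurableSet (B k)) (hd : Pairwise fun j k => Disjoint (B j) (B k))
    (hΛ : ∀ k, Λ (B k) ≠ ∞) (a : Fin m → ℝ) :
    ∫ ω, Real.exp (-∑ k, (Φ ω (B k)).toReal * a k) ∂μ =
      Real.exp (∑ k, Λ.real (B k) * (Real.exp (-a k) - 1)) := by
  have hi := h.indep_count m B hB hd
  have hg : ∀ k, Measurable fun x : ℝ≥0∞ => Real.exp (-(x.toReal * a k)) := fun k => by fun_prop
  have := hi.integral_fun_prod_comp (fun k => (h.measurable_count (hB k)).aemeasurable)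
    (fun k => (hg k).aestronglyMeasurable)
  simp only [← Finset.sum_neg_distrib, Real.exp_sum]
  rw [this]
  refine Finset.prod_congr rfl fun k _ => ?_
  rw [h.integral_comp_count (hB k) (hΛ k) (hg k)]
  have : ∀ n : ℕ, Real.exp (-((n : ℝ≥0∞).toReal * a k)) = Real.exp (-a k) ^ n := fun n => by
    rw [← Real.exp_nat_mul]; simp
  simp only [this]
  rw [integral_pow_poissonMeasure]
  rfl

/-- The level sets of `q` inside `S` are disjoint and of finite intensity, so both integrals become
finite sums over the levels. -/
lemma integral_exp_neg_integral_comp (h : IsPoissonPointProcess μ Φ Λ) {S : Set E}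
    (hS : MeasurableSet S) (hΛ : Λ S ≠ ∞) {m : ℕ} {q : E → Fin m} (hq : Measurable q)
    (a : Fin m → ℝ) :
    ∫ ω, Real.exp (-∫ x in S, a (q x) ∂Φ ω) ∂μ =
      Real.exp (∫ x in S, (Real.exp (-a (q x)) - 1) ∂Λ) := by
  have key : ∀ (ν : Measure E) (b : Fin m → ℝ), ν S ≠ ∞ →
      ∫ x in S, b (q x) ∂ν = ∑ k, ν.real (q ⁻¹' {k} ∩ S) * b k := by
    intro ν b hν
    have : IsFiniteMeasure (ν.restrict S) := isFiniteMeasure_restrict.2 hν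
    rw [← integral_map (φ := q) hq.aemeasurable (by fun_prop), integral_fintype .of_finite]
    refine Finset.sum_congr rfl fun k _ => ?_
    rw [map_measureReal_apply hq (measurableSet_singleton k),
      measureReal_restrict_apply (hq (measurableSet_singleton k)), smul_eq_mul]
  have hBm : ∀ k, MeasurableSet (q ⁻¹' {k} ∩ S) :=
    fun k => (hq (measurableSet_singleton k)).inter hS
  rw [key Λ (fun k => Real.exp (-a k) - 1) hΛ, ← h.integral_exp_neg_sum hBm _
    (fun k => measure_ne_top_of_subset inter_subset_right hΛ)]
  · refine integral_congr_ae ?_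
    filter_upwards [h.ae_count_eq_natCast hS hΛ] with ω ⟨k, hk⟩
    rw [key (Φ ω) a (by simp [hk])]
    rfl
  · intro j k hjk
    refine Disjoint.mono inter_subset_left inter_subset_left ?_
    exact Disjoint.preimage _ (by simpa using hjk)

/-- The Laplace functional of a Poisson point process at a bounded nonnegative function, restricted
to a set of finite intensity. -/
theorem integral_exp_neg_integral [IsProbabilityMeasure μ] (h : IsPoissonPointProcess μ Φ Λ)
    {S : Set E} (hS : MeasurableSet S) (hΛ : Λ S ≠ ∞) {f : E → ℝ} (hf : Measurable f)
    (hf0 : ∀ x, 0 ≤ f x) {C : ℝ} (hfC : ∀ x, f x ≤ C) :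
    ∫ ω, Real.exp (-∫ x in S, f x ∂Φ ω) ∂μ =
      Real.exp (∫ x in S, (Real.exp (-f x) - 1) ∂Λ) := by
  -- Rounding `f` down to multiples of `1 / n` leaves finitely many values, still in `[0, C]`. At `n
  -- = 0` division by zero makes `F` zero, which is harmless.
  set F : ℕ → E → ℝ := fun n x => (⌊(n : ℝ) * f x⌋₊ : ℝ) / n with hF
  have hF0 : ∀ n x, 0 ≤ F n x := fun n x => by positivity
  have hFm : ∀ n, Measurable (F n) := fun n =>
    (measurable_from_top (f := fun k : ℕ => (k : ℝ) / n)).comp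
      (Nat.measurable_floor.comp (hf.const_mul (n : ℝ)))
  have hFf : ∀ n x, F n x ≤ C := by
    intro n x
    rcases Nat.eq_zero_or_pos n with rfl | hn
    · simpa [hF] using (hf0 x).trans (hfC x)
    · have : (0 : ℝ) < n := by exact_mod_cast hn
      refine le_trans ?_ (hfC x)
      rw [hF, div_le_iff₀ this, mul_comm (f x)]
      exact Nat.floor_le (mul_nonneg this.le (hf0 x))
  have hlim : ∀ x, Tendsto (fun n => F n x) atTop (𝓝 (f x)) :=
    fun x => tendsto_floor_mul_div (hf0 x)
  have hstep : ∀ n, ∫ ω, Real.exp (-∫ x in S, F n x ∂Φ ω) ∂μ =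
      Real.exp (∫ x in S, (Real.exp (-F n x) - 1) ∂Λ) := by
    intro n
    -- The highest level that `f ≤ C` can reach, so the reduction modulo `m + 1` in `Fin.ofNat`
    -- changes nothing.
    set m := ⌊(n : ℝ) * C⌋₊ with hm
    set q : E → Fin (m + 1) := fun x => Fin.ofNat (m + 1) ⌊(n : ℝ) * f x⌋₊ with hq
    have hqm : Measurable q := (measurable_from_top (f := fun k : ℕ => Fin.ofNat (m + 1) k)).comp
      (Nat.measurable_floor.comp (hf.const_mul (n : ℝ)))
    have hqF : ∀ x, F n x = ((q x : ℕ) : ℝ) / n := by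
      intro x
      have : ⌊(n : ℝ) * f x⌋₊ < m + 1 := Nat.lt_succ_of_le
        (Nat.floor_le_floor (mul_le_mul_of_nonneg_left (hfC x) (Nat.cast_nonneg n)))
      simp [hF, hq, Fin.ofNat, Nat.mod_eq_of_lt this]
    simp only [hqF]
    exact h.integral_exp_neg_integral_comp hS hΛ hqm fun k => ((k : ℕ) : ℝ) / n
  have hfin : ∀ ν : Measure E, ν S ≠ ∞ → Tendsto (fun n => ∫ x in S, F n x ∂ν) atTop
      (𝓝 (∫ x in S, f x ∂ν)) := by
    intro ν hν
    have : IsFiniteMeasure (ν.restrict S) := isFiniteMeasure_restrict.2 hν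
    refine tendsto_integral_of_dominated_convergence (fun _ => C)
      (fun n => (hFm n).aestronglyMeasurable) (integrable_const _)
      (fun n => ae_of_all _ fun x => ?_) (ae_of_all _ hlim)
    rw [Real.norm_of_nonneg (hF0 n x)]
    exact hFf n x
  have hmeas : ∀ n, AEStronglyMeasurable (fun ω => Real.exp (-∫ x in S, F n x ∂Φ ω)) μ := by
    intro n
    -- Measurability in the measure is available for the lower integral, hence the rewriting.
    have h1 : ∀ ω, ∫ x in S, F n x ∂Φ ω =
        (∫⁻ x, S.indicator (fun x => ENNReal.ofReal (F n x)) x ∂Φ ω).toReal := fun ω => by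
      rw [integral_eq_lintegral_of_nonneg_ae (ae_of_all _ (hF0 n)) (hFm n).aestronglyMeasurable,
        lintegral_indicator hS]
    have h2 : Measurable fun ω =>
        ∫⁻ x, S.indicator (fun x => ENNReal.ofReal (F n x)) x ∂Φ ω :=
      (Measure.measurable_lintegral ((hFm n).ennreal_ofReal.indicator hS)).comp h.measurable
    simp only [h1]
    exact (Real.measurable_exp.comp h2.ennreal_toReal.neg).aestronglyMeasurable
  have hL : Tendsto (fun n => ∫ ω, Real.exp (-∫ x in S, F n x ∂Φ ω) ∂μ) atTop
      (𝓝 (∫ ω, Real.exp (-∫ x in S, f x ∂Φ ω) ∂μ)) := by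
    refine tendsto_integral_of_dominated_convergence (fun _ => 1) hmeas (integrable_const _)
      (fun n => ae_of_all _ fun ω => ?_) ?_
    · rw [Real.norm_of_nonneg (Real.exp_pos _).le, Real.exp_le_one_iff, neg_nonpos]
      exact integral_nonneg (hF0 n)
    · filter_upwards [h.ae_count_eq_natCast hS hΛ] with ω ⟨k, hk⟩
      exact (Real.continuous_exp.tendsto _).comp (hfin (Φ ω) (by simp [hk])).neg
  have hR : Tendsto (fun n => ∫ x in S, (Real.exp (-F n x) - 1) ∂Λ) atTop
      (𝓝 (∫ x in S, (Real.exp (-f x) - 1) ∂Λ)) := by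
    have : IsFiniteMeasure (Λ.restrict S) := isFiniteMeasure_restrict.2 hΛ
    refine tendsto_integral_of_dominated_convergence (fun _ => 1)
      (fun n => ((Real.measurable_exp.comp (hFm n).neg).sub_const 1).aestronglyMeasurable)
      (integrable_const _) (fun n => ae_of_all _ fun x => ?_) (ae_of_all _ fun x => ?_)
    · have h1 : Real.exp (-F n x) ≤ 1 := by simpa using hF0 n x
      have h2 := Real.exp_pos (-F n x)
      rw [Real.norm_eq_abs, abs_le]
      constructor <;> linarith
    · exact ((Real.continuous_exp.tendsto _).comp (hlim x).neg).sub_const 1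
  simp only [hstep] at hL
  exact tendsto_nhds_unique hL ((Real.continuous_exp.tendsto _).comp hR)

end IsPoissonPointProcess

end

/-! ### Independent marks and sums over points. -/

section

open Filter
open scoped Topology

/-- The mass of a section depends measurably on the base point and the measure together, on the
set of finite measures. -/
lemma exists_measurable_measure_section {α E : Type*} [MeasurableSpace α] [MeasurableSpace E]
    {C : Set (α × E)} (hC : MeasurableSet C) :
    ∃ F : α × Measure E → ℝ≥0∞, Measurable F ∧
      ∀ x m, m univ ≠ ∞ → F (x, m) = m (Prod.mk x ⁻¹' C) := by
  classical
  have hU : MeasurableSet {p : α × Measure E | p.2 univ ≠ ∞} :=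
    (((Measure.measurable_coe MeasurableSet.univ).comp measurable_snd)
      (measurableSet_singleton ∞)).compl
  -- The identity kernel, cut to zero at infinite measures: measurability of sections needs finite
  -- measures.
  let κ : Kernel (α × Measure E) E :=
    ⟨fun p => if p.2 univ ≠ ∞ then p.2 else 0, Measurable.ite hU measurable_snd measurable_const⟩
  have hκ : ∀ p, κ p = if p.2 univ ≠ ∞ then p.2 else 0 := fun p => rfl
  have hfin : ∀ p, IsFiniteMeasure (κ p) := by
    intro p
    rw [hκ]
    split_ifs with h
    · exact ⟨h.lt_top⟩
    · infer_instance
  have ht : MeasurableSet {q : (α × Measure E) × E | (q.1.1, q.2) ∈ C} :=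
    (measurable_fst.fst.prodMk measurable_snd) hC
  refine ⟨_, Kernel.measurable_kernel_prodMk_left_of_finite ht hfin, fun x m hm => ?_⟩
  rw [hκ, if_pos hm]
  rfl

/-- The expected product of bounded functions of independent marks at independent points can be
computed by averaging over the marks first. -/
lemma integral_prod_marks {Ω E F : Type*} [MeasurableSpace Ω] [MeasurableSpace E]
    [MeasurableSpace F] {μ : Measure Ω} [IsProbabilityMeasure μ] {X : ℕ → Ω → E} {D : ℕ → Ω → F}
    (hX : ∀ i, Measurable (X i)) (hD : ∀ i, Measurable (D i)) (hDi : iIndepFun D μ)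
    (hXD : IndepFun (fun ω i => X i ω) (fun ω i => D i ω) μ) {g : E × F → ℝ} (hg : Measurable g)
    (hg1 : ∀ p, |g p| ≤ 1) {h : E → ℝ} (hh : Measurable h)
    (hgh : ∀ i x, ∫ ω, g (x, D i ω) ∂μ = h x) (M : ℕ) :
    ∫ ω, ∏ i ∈ Finset.range M, g (X i ω, D i ω) ∂μ =
      ∫ ω, ∏ i ∈ Finset.range M, h (X i ω) ∂μ := by
  have hXm : Measurable fun ω i => X i ω := measurable_pi_lambda _ hX
  have hDm : Measurable fun ω i => D i ω := measurable_pi_lambda _ hD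
  have : IsProbabilityMeasure (μ.map fun ω i => X i ω) :=
    Measure.isProbabilityMeasure_map hXm.aemeasurable
  have : IsProbabilityMeasure (μ.map fun ω i => D i ω) :=
    Measure.isProbabilityMeasure_map hDm.aemeasurable
  let G : (ℕ → E) × (ℕ → F) → ℝ := fun p => ∏ i ∈ Finset.range M, g (p.1 i, p.2 i)
  have hG : Measurable G := Finset.measurable_fun_prod _ fun i _ => by fun_prop
  have hGint : Integrable G ((μ.map fun ω i => X i ω).prod (μ.map fun ω i => D i ω)) := by
    refine Integrable.of_bound hG.aestronglyMeasurable 1 (ae_of_all _ fun p => ?_)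
    rw [Real.norm_eq_abs, Finset.abs_prod]
    exact Finset.prod_le_one (fun _ _ => abs_nonneg _) fun _ _ => hg1 _
  have hH : Measurable fun x : ℕ → E => ∏ i ∈ Finset.range M, h (x i) :=
    Finset.measurable_fun_prod _ fun i _ => by fun_prop
  calc ∫ ω, ∏ i ∈ Finset.range M, g (X i ω, D i ω) ∂μ
      = ∫ p, G p ∂(μ.map fun ω => ((fun i => X i ω), fun i => D i ω)) := by
        rw [integral_map (hXm.prodMk hDm).aemeasurable hG.aestronglyMeasurable]
    _ = ∫ x, ∫ d, G (x, d) ∂(μ.map fun ω i => D i ω) ∂(μ.map fun ω i => X i ω) := by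
        rw [hXD.map_prod_eq_prod_map_map hXm.aemeasurable hDm.aemeasurable, integral_prod _ hGint]
    _ = ∫ x, ∏ i ∈ Finset.range M, h (x i) ∂(μ.map fun ω i => X i ω) := by
        congr 1 with x
        have hGx : Measurable fun d => G (x, d) := hG.comp measurable_prodMk_left
        rw [integral_map hDm.aemeasurable hGx.aestronglyMeasurable]
        -- The product formula needs a finite index type, so the family is restricted to `Fin M`.
        have hi := hDi.precomp (g := fun i : Fin M => (i : ℕ)) Fin.val_injective
        have := hi.integral_fun_prod_comp (f := fun (i : Fin M) d => g (x i, d))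
          (fun i => (hD i).aemeasurable)
          (fun i => (hg.comp measurable_prodMk_left).aestronglyMeasurable)
        simp only [hgh] at this
        simp only [G, ← Fin.prod_univ_eq_prod_range (fun i => h (x i)),
          ← Fin.prod_univ_eq_prod_range (fun i => g (x i, _))]
        exact this
    _ = _ := by rw [integral_map hXm.aemeasurable hH.aestronglyMeasurable]

/-- Fubini: the joint law is a product, so null sets that depend on the fixed point `x` remain
negligible at an independent random point. -/
lemma ae_of_indepFun_of_forall_ae {Ω E F : Type*} [MeasurableSpace Ω] [MeasurableSpace E]
    [MeasurableSpace F] {μ : Measure Ω} [IsProbabilityMeasure μ] {X : Ω → E} {D : Ω → F}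
    (hX : Measurable X) (hD : Measurable D) (hXD : IndepFun X D μ) {T : Set (E × F)}
    (hT : MeasurableSet T) (h : ∀ x, ∀ᵐ ω ∂μ, (x, D ω) ∈ T) : ∀ᵐ ω ∂μ, (X ω, D ω) ∈ T := by
  have : IsProbabilityMeasure (μ.map X) := Measure.isProbabilityMeasure_map hX.aemeasurable
  have : IsProbabilityMeasure (μ.map D) := Measure.isProbabilityMeasure_map hD.aemeasurable
  refine ae_of_ae_map (f := fun ω => (X ω, D ω)) (hX.prodMk hD).aemeasurable ?_
  rw [hXD.map_prod_eq_prod_map_map hX.aemeasurable hD.aemeasurable,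
    Measure.ae_prod_mem_iff_ae_ae_mem hT]
  refine ae_of_all _ fun x => ?_
  exact (ae_map_iff hD.aemeasurable (measurable_prodMk_left hT)).2 (h x)

/-- A locally integrable sum over the points of a point process is an integral. -/
lemma hasSum_integral_sum_dirac_of_support {E : Type*} [MeasurableSpace E]
    [MeasurableSingletonClass E] {x : ℕ → E} {S : Set E}
    (hfin : Measure.sum (fun i => Measure.dirac (x i)) S ≠ ∞) {f : E → ℝ} (hf : Measurable f)
    {C : ℝ} (hfC : ∀ y, |f y| ≤ C) (hf0 : ∀ y ∉ S, f y = 0) :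
    HasSum (fun i => f (x i)) (∫ y in S, f y ∂Measure.sum (fun i => Measure.dirac (x i))) := by
  have hint : IntegrableOn f S (Measure.sum fun i => Measure.dirac (x i)) := by
    have : IsFiniteMeasure ((Measure.sum fun i => Measure.dirac (x i)).restrict S) :=
      isFiniteMeasure_restrict.2 hfin
    exact Integrable.of_bound hf.aestronglyMeasurable C (ae_of_all _ hfC)
  rw [integrableOn_iff_integrable_of_support_subset
    (Function.support_subset_iff'.2 hf0)] at hint
  rw [setIntegral_eq_integral_of_forall_compl_eq_zero hf0]
  simpa using hasSum_integral_measure hint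

/-- Each index with `x i ∈ S` adds 1 to a finite sum. -/
lemma finite_setOf_mem_of_sum_dirac_ne_top {E : Type*} [MeasurableSpace E] {x : ℕ → E} {S : Set E}
    (hS : MeasurableSet S) (hfin : Measure.sum (fun i => Measure.dirac (x i)) S ≠ ∞) :
    {i | x i ∈ S}.Finite := by
  rw [Measure.sum_apply _ hS] at hfin
  refine (ENNReal.finite_const_le_of_tsum_ne_top hfin one_ne_zero).subset fun i hi => ?_
  simp only [mem_ofPred_eq] at hi ⊢
  rw [Measure.dirac_apply' _ hS, indicator_of_mem hi, Pi.one_apply]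

end

/-! ### Overlap of two intervals and the closed form of the exponent. -/

section IntersectionVolume

/-- The outer maximum with 0 accounts for disjoint intervals. Continuity, evenness and every case of
the overlap formula are read off from this form. -/
lemma interVol_eq_max (r rd x : ℝ) :
    interVol r rd x = max 0 (min r (x + rd) - max (-r) (x - rd)) := by
  rw [interVol, Real.closedBall_eq_Icc, Real.closedBall_eq_Icc, Icc_inter_Icc, Real.volume_Icc,
    ENNReal.toReal_ofReal', max_comm]
  simp

lemma continuous_interVol (r rd : ℝ) : Continuous fun x : ℝ => interVol r rd x := by
  simp only [interVol_eq_max]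
  fun_prop

lemma interVol_abs (r rd x : ℝ) : interVol r rd |x| = interVol r rd x := by
  rw [interVol_eq_max, interVol_eq_max]
  rcases abs_cases x with ⟨h, _⟩ | ⟨h, _⟩ <;> rw [h]
  congr 1
  rw [show -x + rd = -(x - rd) by ring, show -x - rd = -(x + rd) by ring, max_neg_neg]
  nth_rewrite 1 [← neg_neg r]
  rw [min_neg_neg]
  ring

lemma interVol_nonneg (r rd x : ℝ) : 0 ≤ interVol r rd x := ENNReal.toReal_nonneg

lemma interVol_le {r : ℝ} (hr : 0 ≤ r) (rd x : ℝ) : interVol r rd x ≤ 2 * r := by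
  rw [interVol_eq_max]
  refine max_le (by linarith) ?_
  linarith [min_le_left r (x + rd), le_max_left (-r) (x - rd)]

lemma interVol_of_abs_le {r rd x : ℝ} (hr : 0 ≤ r) (hrd : 0 ≤ rd) (hx : |x| ≤ |r - rd|) :
    interVol r rd x = 2 * min r rd := by
  rw [← interVol_abs, interVol_eq_max]
  have := abs_nonneg x
  rcases le_total r rd with h | h
  · rw [abs_of_nonpos (by linarith : r - rd ≤ 0)] at hx
    rw [min_eq_left h, min_eq_left (by linarith), max_eq_left (a := -r) (by linarith),
      max_eq_right (by linarith)]
    ring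
  · rw [abs_of_nonneg (by linarith : 0 ≤ r - rd)] at hx
    rw [min_eq_right h, min_eq_right (by linarith), max_eq_right (a := -r) (by linarith),
      max_eq_right (by linarith)]
    ring

lemma interVol_of_le_abs {r rd x : ℝ} (h1 : |r - rd| ≤ |x|) (h2 : |x| ≤ r + rd) :
    interVol r rd x = r + rd - |x| := by
  rw [← interVol_abs, interVol_eq_max]
  have := abs_le.1 h1
  rw [min_eq_left (by linarith), max_eq_right (a := -r) (by linarith), max_eq_right (by linarith)]
  ring

lemma interVol_of_lt_abs {r rd x : ℝ} (hx : r + rd < |x|) : interVol r rd x = 0 := by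
  rw [← interVol_abs, interVol_eq_max]
  refine max_eq_left ?_
  linarith [min_le_left r (|x| + rd), le_max_right (-r) (|x| - rd)]

lemma intervalIntegral_even {f : ℝ → ℝ} (hf : Continuous f) (he : ∀ x, f |x| = f x) (R : ℝ) :
    ∫ x in (-R)..R, f x = 2 * ∫ x in (0 : ℝ)..R, f x := by
  have h1 : ∫ x in (-R)..0, f x = ∫ x in (0 : ℝ)..R, f x := by
    rw [← neg_zero, ← intervalIntegral.integral_comp_neg, neg_zero]
    refine intervalIntegral.integral_congr fun x _ => ?_
    rw [← he, abs_neg, he]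
  rw [← intervalIntegral.integral_add_adjacent_intervals (hf.intervalIntegrable _ _)
    (hf.intervalIntegrable 0 R), h1]
  ring

/-- The integral splits at `|r - rd|`: the integrand is constant before it, and after it an
exponential of a linear function, integrated by the substitution `y = r + rd - x`. -/
lemma pgfExponent_eq {lamP lamD rd r s : ℝ} (hlamD : lamD ≠ 0) (hrd : 0 ≤ rd) (hr : 0 ≤ r)
    (hs : s ≠ 1) :
    pgfExponent lamP lamD rd r s =
      2 * lamP * (|r - rd| * Real.exp (lamD * (2 * min r rd) * (s - 1)) - (r + rd) +
        (Real.exp (lamD * (s - 1) * (2 * min r rd)) - 1) / (lamD * (s - 1))) := by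
  have hc : Continuous fun x : ℝ => Real.exp (lamD * interVol r rd x * (s - 1)) := by
    have := continuous_interVol r rd
    fun_prop
  have hle : |r - rd| ≤ r + rd := by rw [abs_le]; constructor <;> linarith
  have hne : lamD * (s - 1) ≠ 0 := mul_ne_zero hlamD (sub_ne_zero.2 hs)
  have h0 : 0 ≤ |r - rd| := abs_nonneg _
  have h1 : ∫ x in (0 : ℝ)..|r - rd|, Real.exp (lamD * interVol r rd x * (s - 1)) =
      |r - rd| * Real.exp (lamD * (2 * min r rd) * (s - 1)) := by
    rw [intervalIntegral.integral_congr (g := fun _ =>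
      Real.exp (lamD * (2 * min r rd) * (s - 1))), intervalIntegral.integral_const, smul_eq_mul,
      sub_zero]
    intro x hx
    rw [uIcc_of_le h0] at hx
    simp only
    rw [interVol_of_abs_le hr hrd (by rw [abs_of_nonneg hx.1]; exact hx.2)]
  have h2 : ∫ x in |r - rd|..(r + rd), Real.exp (lamD * interVol r rd x * (s - 1)) =
      (Real.exp (lamD * (s - 1) * (2 * min r rd)) - 1) / (lamD * (s - 1)) := by
    rw [intervalIntegral.integral_congr (g := fun x =>
      Real.exp (lamD * (s - 1) * ((r + rd) - x)))]
    · rw [intervalIntegral.integral_comp_sub_left (fun y => Real.exp (lamD * (s - 1) * y)),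
        intervalIntegral.integral_comp_mul_left _ hne, integral_exp, sub_self, mul_zero,
        Real.exp_zero, smul_eq_mul, inv_mul_eq_div]
      -- What remains is `r + rd - |r - rd| = 2 * min r rd`.
      congr 4
      rcases le_total r rd with h | h
      · rw [abs_of_nonpos (by linarith), min_eq_left h]; ring
      · rw [abs_of_nonneg (by linarith), min_eq_right h]; ring
    · intro x hx
      rw [uIcc_of_le hle] at hx
      have hx0 : |x| = x := abs_of_nonneg (h0.trans hx.1)
      simp only
      rw [interVol_of_le_abs (by rw [hx0]; exact hx.1) (by rw [hx0]; exact hx.2), hx0]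
      ring_nf
  rw [pgfExponent, ← intervalIntegral.integral_add_adjacent_intervals
    (hc.intervalIntegrable 0 |r - rd|) (hc.intervalIntegrable _ _), h1, h2]
  ring

end IntersectionVolume

/-! ### The cluster process and its generating function. -/

section

open Filter
open scoped Topology

lemma clusterProcess_closedBall {Ω : Type*} {X : ℕ → Ω → ℝ} {D : ℕ → Ω → Measure ℝ} (r : ℝ)
    (ω : Ω) :
    clusterProcess X D ω (closedBall 0 r) =
      ∑' i, D i ω ((fun y => X i ω + y) ⁻¹' closedBall 0 r) := by
  rw [clusterProcess, Measure.sum_apply _ measurableSet_closedBall]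
  exact tsum_congr fun i => Measure.map_apply (measurable_const_add _) measurableSet_closedBall

lemma numPoints_eq_of_apply_eq {Ω E : Type*} [NormedAddCommGroup E] [MeasurableSpace E]
    {Φ : Ω → Measure E} {r : ℝ} {ω : Ω} {k : ℕ} (h : Φ ω (closedBall 0 r) = k) :
    numPoints Φ r ω = k := by
  rw [numPoints, h]
  simp

namespace IsMaternClusterData

variable {Ω : Type*} [MeasurableSpace Ω] {μ : Measure Ω} {lamP lamD rd r : ℝ}
  {X : ℕ → Ω → ℝ} {D : ℕ → Ω → Measure ℝ}

lemma daughter_intensity_ne_top (B : Set ℝ) :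
    (ENNReal.ofReal lamD • (volume : Measure ℝ).restrict (closedBall 0 rd)) B ≠ ∞ := by
  rw [Measure.smul_apply, smul_eq_mul]
  refine ENNReal.mul_ne_top ENNReal.ofReal_ne_top (ne_top_of_le_ne_top ?_ (measure_mono
    (subset_univ B)))
  rw [Measure.restrict_apply_univ]
  exact measure_closedBall_lt_top.ne

lemma parent_intensity_ne_top (R : ℝ) :
    (ENNReal.ofReal lamP • (volume : Measure ℝ)) (closedBall 0 R) ≠ ∞ :=
  ENNReal.mul_ne_top ENNReal.ofReal_ne_top measure_closedBall_lt_top.ne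

/-- Translating by `x` moves the daughter ball to `closedBall x rd`, and Lebesgue measure is
invariant. -/
lemma daughter_intensity_preimage (hlamD : 0 ≤ lamD) (x : ℝ) :
    ((ENNReal.ofReal lamD • (volume : Measure ℝ).restrict (closedBall 0 rd))
      ((fun y => x + y) ⁻¹' closedBall 0 r)).toReal = lamD * interVol r rd x := by
  have h : (fun y => x + y) ⁻¹' closedBall (0 : ℝ) r ∩ closedBall 0 rd =
      (fun y => x + y) ⁻¹' (closedBall 0 r ∩ closedBall x rd) := by
    ext y
    simp [dist_eq_norm]
  have hm : MeasurableSet ((fun y => x + y) ⁻¹' closedBall (0 : ℝ) r) :=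
    (measurable_const_add x) measurableSet_closedBall
  rw [Measure.smul_apply, Measure.restrict_apply hm, h, measure_preimage_add, smul_eq_mul,
    ENNReal.toReal_mul, ENNReal.toReal_ofReal hlamD, interVol]

/-- The number of daughters, in a ball around the origin, of a parent at a given location. -/
lemma exists_measurable_daughterCount (h : IsMaternClusterData μ lamP lamD rd X D) (r : ℝ) :
    ∃ G : ℝ × Measure ℝ → ℕ, Measurable G ∧
      (∀ i x, ∀ᵐ ω ∂μ, D i ω ((fun y => x + y) ⁻¹' closedBall 0 r) = G (x, D i ω)) ∧
      ∀ [IsProbabilityMeasure μ], ∀ᵐ ω ∂μ, ∀ i,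
        D i ω ((fun y => X i ω + y) ⁻¹' closedBall 0 r) = G (X i ω, D i ω) := by
  have hC : MeasurableSet {p : ℝ × ℝ | p.1 + p.2 ∈ closedBall (0 : ℝ) r} :=
    (measurable_fst.add measurable_snd) measurableSet_closedBall
  obtain ⟨F, hF, hFC⟩ := exists_measurable_measure_section hC
  have hsec : ∀ x : ℝ, Prod.mk x ⁻¹' {p : ℝ × ℝ | p.1 + p.2 ∈ closedBall (0 : ℝ) r} =
      (fun y => x + y) ⁻¹' closedBall 0 r := fun x => rfl
  simp only [hsec] at hFC
  have hfin : ∀ i, ∀ᵐ ω ∂μ, D i ω univ ≠ ∞ := fun i => by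
    filter_upwards [(h.daughter_poisson i).ae_count_eq_natCast MeasurableSet.univ
      (daughter_intensity_ne_top _)] with ω ⟨k, hk⟩
    simp [hk]
  have hG : Measurable fun p => ⌊(F p).toReal⌋₊ := Nat.measurable_floor.comp hF.ennreal_toReal
  have hfix : ∀ i x, ∀ᵐ ω ∂μ, F (x, D i ω) = (⌊(F (x, D i ω)).toReal⌋₊ : ℝ≥0∞) := fun i x => by
    filter_upwards [(h.daughter_poisson i).ae_count_eq_natCast
      ((measurable_const_add x) measurableSet_closedBall)
      (daughter_intensity_ne_top ((fun y => x + y) ⁻¹' closedBall 0 r)), hfin i] with ω ⟨k, hk⟩ hu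
    rw [hFC _ _ hu, hk]
    simp
  -- Integrality of the count holds almost surely at each fixed `x`; measurability of this set lets
  -- independence carry it to the random parent.
  have hT : MeasurableSet {p | F p = (⌊(F p).toReal⌋₊ : ℝ≥0∞)} :=
    measurableSet_eq_fun hF (measurable_from_top.comp hG)
  refine ⟨_, hG, fun i x => ?_, ?_⟩
  · filter_upwards [hfix i x, hfin i] with ω h1 h2
    rw [← h1, hFC _ _ h2]
  · intro _
    refine ae_all_iff.2 fun i => ?_
    have hXD : IndepFun (X i) (D i) μ :=
      h.parent_daughter_indep.comp (measurable_pi_apply i) (measurable_pi_apply i)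
    filter_upwards [ae_of_indepFun_of_forall_ae (h.measurable_parent i)
      (h.daughter_poisson i).measurable hXD hT (hfix i), hfin i] with ω h1 h2
    rw [← h1, hFC _ _ h2]

lemma ae_parents_finite (h : IsMaternClusterData μ lamP lamD rd X D) (R : ℝ) :
    ∀ᵐ ω ∂μ, Measure.sum (fun i => Measure.dirac (X i ω)) (closedBall 0 R) ≠ ∞ := by
  filter_upwards [h.parent_poisson.ae_count_eq_natCast measurableSet_closedBall
    (parent_intensity_ne_top R)] with ω ⟨k, hk⟩
  simp [hk]

lemma ae_daughter_confined (h : IsMaternClusterData μ lamP lamD rd X D) :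
    ∀ᵐ ω ∂μ, ∀ i, D i ω (closedBall 0 rd)ᶜ = 0 := by
  refine ae_all_iff.2 fun i => (h.daughter_poisson i).ae_count_eq_zero
    measurableSet_closedBall.compl ?_
  rw [Measure.smul_apply, Measure.restrict_apply measurableSet_closedBall.compl]
  simp

/-- Almost surely the number of points in a ball is the sum of the contributions of finitely many
parents. -/
lemma ae_eventually_clusterProcess_eq [IsProbabilityMeasure μ]
    (h : IsMaternClusterData μ lamP lamD rd X D) {G : ℝ × Measure ℝ → ℕ}
    (hG : ∀ᵐ ω ∂μ, ∀ i, D i ω ((fun y => X i ω + y) ⁻¹' closedBall 0 r) = G (X i ω, D i ω)) :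
    ∀ᵐ ω ∂μ, ∀ᶠ M in atTop, clusterProcess X D ω (closedBall 0 r) =
      ((∑ i ∈ Finset.range M, G (X i ω, D i ω) : ℕ) : ℝ≥0∞) := by
  filter_upwards [hG, h.ae_parents_finite (r + rd), h.ae_daughter_confined] with ω h1 h2 h3
  obtain ⟨M₀, hM₀⟩ := (finite_setOf_mem_of_sum_dirac_ne_top measurableSet_closedBall h2).bddAbove
  filter_upwards [eventually_gt_atTop M₀] with M hM
  rw [clusterProcess_closedBall, tsum_eq_sum (s := Finset.range M)]
  · push_cast
    exact Finset.sum_congr rfl fun i _ => h1 i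
  · intro i hi
    -- A daughter within `rd` of its parent and landing in the ball forces the parent into radius `r
    -- + rd`, hence an index at most `M₀`.
    refine measure_mono_null (fun y hy => fun hy' => hi ?_) (h3 i)
    rw [mem_preimage, mem_closedBall_zero_iff] at hy
    rw [mem_closedBall_zero_iff] at hy'
    refine Finset.mem_range.2 ((hM₀ ?_).trans_lt hM)
    rw [mem_ofPred_eq, mem_closedBall_zero_iff]
    calc ‖X i ω‖ = ‖(X i ω + y) - y‖ := by rw [add_sub_cancel_right]
      _ ≤ r + rd := (norm_sub_le _ _).trans (add_le_add hy hy')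

/-- The probability generating function of the number of daughters in a ball of a parent at a
given location. -/
lemma integral_pow_daughterCount (h : IsMaternClusterData μ lamP lamD rd X D) (hlamD : 0 ≤ lamD)
    {G : ℝ × Measure ℝ → ℕ} {i : ℕ} {x : ℝ}
    (hG : ∀ᵐ ω ∂μ, D i ω ((fun y => x + y) ⁻¹' closedBall 0 r) = G (x, D i ω)) (s : ℝ) :
    ∫ ω, s ^ G (x, D i ω) ∂μ = Real.exp (-(lamD * interVol r rd x * (1 - s))) := by
  have hg : Measurable fun z : ℝ≥0∞ => s ^ ⌊z.toReal⌋₊ :=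
    measurable_from_top.comp (Nat.measurable_floor.comp ENNReal.measurable_toReal)
  have := (h.daughter_poisson i).integral_comp_count
    ((measurable_const_add x) measurableSet_closedBall)
    (daughter_intensity_ne_top ((fun y => x + y) ⁻¹' closedBall 0 r)) hg
  simp only [ENNReal.toReal_natCast, Nat.floor_natCast] at this
  rw [integral_pow_poissonMeasure, ENNReal.coe_toNNReal_eq_toReal,
    daughter_intensity_preimage hlamD] at this
  rw [show -(lamD * interVol r rd x * (1 - s)) = lamD * interVol r rd x * (s - 1) by ring, ← this]
  refine integral_congr_ae ?_
  filter_upwards [hG] with ω hω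
  rw [hω]
  simp

/-- The Laplace functional of the parents, evaluated for the probability generating function. -/
lemma integral_exp_neg_parents [IsProbabilityMeasure μ]
    (h : IsMaternClusterData μ lamP lamD rd X D) (hlamP : 0 ≤ lamP) (hlamD : 0 ≤ lamD)
    (hrd : 0 ≤ rd) (hr : 0 ≤ r) {s : ℝ} (hs : s ≤ 1) :
    ∫ ω, Real.exp (-∫ x in closedBall 0 (r + rd), lamD * interVol r rd x * (1 - s)
      ∂Measure.sum fun i => Measure.dirac (X i ω)) ∂μ =
      Real.exp (pgfExponent lamP lamD rd r s) := by
  have hf : Continuous fun x : ℝ => lamD * interVol r rd x * (1 - s) :=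
    ((continuous_interVol r rd).const_mul lamD).mul_const _
  have hs' : 0 ≤ 1 - s := sub_nonneg.2 hs
  rw [h.parent_poisson.integral_exp_neg_integral measurableSet_closedBall
    (parent_intensity_ne_top _) hf.measurable
    (fun x => mul_nonneg (mul_nonneg hlamD (interVol_nonneg _ _ _)) hs')
    (C := lamD * (2 * r) * (1 - s))
    (fun x => mul_le_mul_of_nonneg_right
      (mul_le_mul_of_nonneg_left (interVol_le hr _ _) hlamD) hs')]
  congr 1
  have hc : Continuous fun x : ℝ => Real.exp (lamD * interVol r rd x * (s - 1)) :=
    Real.continuous_exp.comp (((continuous_interVol r rd).const_mul lamD).mul_const _)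
  have hR : 0 ≤ r + rd := add_nonneg hr hrd
  have hneg : ∀ x : ℝ, -(lamD * interVol r rd x * (1 - s)) = lamD * interVol r rd x * (s - 1) :=
    fun x => by ring
  simp only [hneg]
  rw [Measure.restrict_smul, integral_smul_measure, ENNReal.toReal_ofReal hlamP,
    Real.closedBall_eq_Icc, integral_Icc_eq_integral_Ioc, zero_sub, zero_add,
    ← intervalIntegral.integral_of_le (by linarith),
    intervalIntegral.integral_sub (hc.intervalIntegrable _ _) intervalIntegrable_const,
    intervalIntegral_even hc (fun x => by rw [interVol_abs]), intervalIntegral.integral_const,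
    pgfExponent, smul_eq_mul, smul_eq_mul]
  ring

/-- The number of points of a Matérn cluster process in a ball has the expected probability
generating function. -/
theorem integrable_and_integral_pow_numPoints [IsProbabilityMeasure μ]
    (h : IsMaternClusterData μ lamP lamD rd X D) (hlamP : 0 ≤ lamP) (hlamD : 0 ≤ lamD)
    (hrd : 0 ≤ rd) (hr : 0 ≤ r) {s : ℝ} (hs : |s| ≤ 1) :
    Integrable (fun ω => s ^ numPoints (clusterProcess X D) r ω) μ ∧
      ∫ ω, s ^ numPoints (clusterProcess X D) r ω ∂μ =
        Real.exp (pgfExponent lamP lamD rd r s) := by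
  obtain ⟨G, hGm, hGx, hGX⟩ := h.exists_measurable_daughterCount r
  have hX := h.measurable_parent
  have hD := fun i => (h.daughter_poisson i).measurable
  -- Minus the logarithm of the generating function of one parent's contribution.
  set f : ℝ → ℝ := fun x => lamD * interVol r rd x * (1 - s) with hfdef
  have hf : Continuous f := ((continuous_interVol r rd).const_mul lamD).mul_const _
  have hs' : 0 ≤ 1 - s := sub_nonneg.2 ((le_abs_self s).trans hs)
  have hf0 : ∀ x, 0 ≤ f x := fun x => mul_nonneg (mul_nonneg hlamD (interVol_nonneg _ _ _)) hs'
  have hfC : ∀ x, |f x| ≤ lamD * (2 * r) * (1 - s) := fun x => by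
    rw [abs_of_nonneg (hf0 x)]
    exact mul_le_mul_of_nonneg_right
      (mul_le_mul_of_nonneg_left (interVol_le hr _ _) hlamD) hs'
  have hfS : ∀ x ∉ closedBall (0 : ℝ) (r + rd), f x = 0 := fun x hx => by
    rw [mem_closedBall_zero_iff, not_le] at hx
    simp [hfdef, interVol_of_lt_abs hx]
  have hg : Measurable fun p => s ^ G p := measurable_from_top.comp hGm
  have hg1 : ∀ p, |s ^ G p| ≤ 1 := fun p => by
    rw [abs_pow]
    exact pow_le_one₀ (abs_nonneg _) hs
  have hpartial := fun M => integral_prod_marks hX hD h.daughter_indep h.parent_daughter_indep hg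
    hg1 (h := fun x => Real.exp (-f x)) (by fun_prop)
    (fun i x => h.integral_pow_daughterCount hlamD (hGx i x) s) M
  have hLm : ∀ M, AEStronglyMeasurable
      (fun ω => ∏ i ∈ Finset.range M, s ^ G (X i ω, D i ω)) μ := fun M =>
    (Finset.measurable_fun_prod _ fun i _ =>
      hg.comp ((hX i).prodMk (hD i))).aestronglyMeasurable
  -- The partial products are eventually constant.
  have hLlim : ∀ᵐ ω ∂μ, Tendsto (fun M => ∏ i ∈ Finset.range M, s ^ G (X i ω, D i ω)) atTop
      (𝓝 (s ^ numPoints (clusterProcess X D) r ω)) := by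
    filter_upwards [h.ae_eventually_clusterProcess_eq hGX] with ω hω
    refine tendsto_const_nhds.congr' ?_
    filter_upwards [hω] with M hM
    rw [numPoints_eq_of_apply_eq hM, Finset.prod_pow_eq_pow_sum]
  have hL : Tendsto (fun M => ∫ ω, ∏ i ∈ Finset.range M, s ^ G (X i ω, D i ω) ∂μ) atTop
      (𝓝 (∫ ω, s ^ numPoints (clusterProcess X D) r ω ∂μ)) := by
    refine tendsto_integral_of_dominated_convergence (fun _ => 1) hLm (integrable_const _)
      (fun M => ae_of_all _ fun ω => ?_) hLlim
    rw [Real.norm_eq_abs, Finset.abs_prod]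
    exact Finset.prod_le_one (fun _ _ => abs_nonneg _) fun _ _ => hg1 _
  have hR : Tendsto (fun M => ∫ ω, ∏ i ∈ Finset.range M, Real.exp (-f (X i ω)) ∂μ) atTop
      (𝓝 (∫ ω, Real.exp (-∫ x in closedBall 0 (r + rd), f x
        ∂Measure.sum fun i => Measure.dirac (X i ω)) ∂μ)) := by
    refine tendsto_integral_of_dominated_convergence (fun _ => 1)
      (fun M => (Finset.measurable_fun_prod _ fun i _ => ?_).aestronglyMeasurable)
      (integrable_const _) (fun M => ae_of_all _ fun ω => ?_) ?_
    · exact Real.measurable_exp.comp (hf.measurable.comp (hX i)).neg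
    · rw [Real.norm_of_nonneg (Finset.prod_nonneg fun _ _ => (Real.exp_pos _).le)]
      exact Finset.prod_le_one (fun _ _ => (Real.exp_pos _).le) fun _ _ => by simpa using hf0 _
    · filter_upwards [h.ae_parents_finite (r + rd)] with ω hω
      have := (hasSum_integral_sum_dirac_of_support hω hf.measurable hfC hfS).tendsto_sum_nat
      simp only [← Real.exp_sum, Finset.sum_neg_distrib]
      exact (Real.continuous_exp.tendsto _).comp this.neg
  simp only [hpartial] at hL
  rw [h.integral_exp_neg_parents hlamP hlamD hrd hr (sub_nonneg.1 hs')] at hR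
  -- Measurability of `s ^ N` up to a null set is inherited from the partial products.
  refine ⟨Integrable.of_bound (aestronglyMeasurable_of_tendsto_ae _ hLm hLlim) 1
    (ae_of_all _ fun ω => ?_), tendsto_nhds_unique hL hR⟩
  rw [Real.norm_eq_abs, abs_pow]
  exact pow_le_one₀ (abs_nonneg _) hs

end IsMaternClusterData

end

theorem corollary1 {Ω : Type*} [MeasurableSpace Ω] (μ : Measure Ω) [IsProbabilityMeasure μ]
    (lamP lamD rd r : ℝ) (hlamP : 0 < lamP) (hlamD : 0 < lamD) (hrd : 0 < rd) (hr : 0 ≤ r)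
    (X : ℕ → Ω → ℝ) (D : ℕ → Ω → Measure ℝ)
    (hMCP : IsMaternClusterData μ lamP lamD rd X D) :
    (∀ x : ℝ,
      (|x| ≤ |r - rd| → interVol r rd x = 2 * min r rd) ∧
      (|r - rd| ≤ |x| → |x| ≤ r + rd → interVol r rd x = r + rd - |x|)) ∧
    (∀ᵐ ω ∂μ, clusterProcess X D ω (closedBall 0 r) = numPoints (clusterProcess X D) r ω) ∧
    (∀ s : ℝ, |s| ≤ 1 →
      Integrable (fun ω => s ^ numPoints (clusterProcess X D) r ω) μ ∧
      ∫ ω, s ^ numPoints (clusterProcess X D) r ω ∂μ =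
        Real.exp (pgfExponent lamP lamD rd r s)) ∧
    (∀ s : ℝ, s ≠ 1 →
      pgfExponent lamP lamD rd r s =
        2 * lamP * (|r - rd| * Real.exp (lamD * (2 * min r rd) * (s - 1)) - (r + rd) +
          (Real.exp (lamD * (s - 1) * (2 * min r rd)) - 1) / (lamD * (s - 1)))) := by
  refine ⟨fun x => ⟨interVol_of_abs_le hr hrd.le, interVol_of_le_abs⟩, ?_, fun s hs =>
    hMCP.integrable_and_integral_pow_numPoints hlamP.le hlamD.le hrd.le hr hs, fun s hs =>
    pgfExponent_eq hlamD.ne' hrd.le hr hs⟩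
  obtain ⟨G, -, -, hGX⟩ := hMCP.exists_measurable_daughterCount r
  filter_upwards [hMCP.ae_eventually_clusterProcess_eq hGX] with ω hω
  obtain ⟨M, hM⟩ := hω.exists
  rw [numPoints_eq_of_apply_eq hM, hM]
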